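/- Let $n\ge 0$, $X\subseteq\{0,1\}^n$ and $f\colon X\to\{0,1\}$. A QMA query protocol for $f$ with witness length $m$ and query cost $q$ is a quantum query algorithm (Arthur) that starts with an $m$-qubit witness state $|\psi\rangle$ together with query and work registers in a fixed basis state, applies $U_q O_x U_{q-1}O_x\cdots O_xU_0$, where $U_0,\dots,U_q$ are unitaries independent of $x$ and $O_x$ is the query operator $|i,b\rangle\mapsto|i,b\oplus x_i\rangle$ (tensored with the identity on the other qubits), and measures in the computational basis to accept or reject. It is required that for every $x\in f^{-1}(1)$ some witness state makes Arthur accept with probability at least $2/3$, and that for every $x\in f^{-1}(0)$ every witness state makes Arthur accept with probability at most $1/3$. There is an absolute constant $C$ such that the following holds for all $n$, $X$, $f$, $m$, $q$ as above: if $f$ has a QMA query protocol with witness length $m$ and query cost $q$, then there is a real polynomial $p$ in $n$ variables, of total degree $\deg p\le C\,mq$, such that $$|p(x)|\le 2^{-2m}\quad\text{for all }x\in f^{-1}(0),\qquad\qquad p(x)\ge 2^{-m-1}\quad\text{for all }x\in f^{-1}(1).$$ -/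

import Mathlib

namespace QMAQuery

/-- Labels of the computational basis states `|i, b, w, z⟩` of Arthur's machine, for an `n`-bit input:
a query register `i` (an input position, or `none`, meaning "query nothing"), an answer qubit `b`,
the `m` witness qubits `w`, and `a` further work qubits `z`. -/
abbrev Label (n m a : ℕ) : Type :=
  Option (Fin n) × Bool × (Fin m → Bool) × (Fin a → Bool)

/-- A state vector of Arthur's machine, given by its amplitudes in the computational basis. -/
abbrev StateVec (n m a : ℕ) : Type := Label n m a → ℂ

/-- The answer to a query: the queried bit of the input, and `0` for the empty query. -/
def answer {n : ℕ} (x : Fin n → Bool) : Option (Fin n) → Bool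
  | none => false
  | some i => x i

/-- The query operator `O_x`, the linear map with `|i, b, w, z⟩ ↦ |i, b ⊕ x_i, w, z⟩`.
In amplitudes: the new amplitude at a label is the old amplitude at its (unique) preimage, and the
map of labels is an involution. -/
def oracle {n m a : ℕ} (x : Fin n → Bool) (v : StateVec n m a) : StateVec n m a :=
  fun ⟨i, b, w, z⟩ => v (i, xor b (answer x i), w, z)

/-- The initial state `|none, 0⟩ ⊗ |ψ⟩ ⊗ |0…0⟩`, where `ψ` is the state of the `m` witness qubits. -/
def initial {n m a : ℕ} (ψ : EuclideanSpace ℂ (Fin m → Bool)) : StateVec n m a :=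
  fun ⟨i, b, w, z⟩ => if i = none ∧ b = false ∧ z = (fun _ => false) then ψ w else 0

/-- Arthur in a quantum Merlin–Arthur query protocol on `n`-bit inputs with an `m`-qubit witness and
`q` queries: a number of work qubits, the input-independent unitaries `U 0, …, U q` applied before,
between and after the queries, and the set of outcomes of the final measurement in the
computational basis on which Arthur accepts. -/
structure Arthur (n m q : ℕ) where
  work : ℕ
  U : Fin (q + 1) → Matrix.unitaryGroup (Label n m work) ℂ
  accepting : Finset (Label n m work)

namespace Arthur

variable {n m q : ℕ}

/-- The state after `k` queries: `U k · O_x · U (k-1) ⋯ O_x · U 0` applied to the initial state. -/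
def stateAfter (A : Arthur n m q) (x : Fin n → Bool) (ψ : EuclideanSpace ℂ (Fin m → Bool)) :
    (k : ℕ) → k < q + 1 → StateVec n m A.work
  | 0, h => Matrix.mulVec (A.U ⟨0, h⟩).1 (initial ψ)
  | k + 1, h => Matrix.mulVec (A.U ⟨k + 1, h⟩).1
      (oracle x (A.stateAfter x ψ k (Nat.lt_of_succ_lt h)))

/-- The probability that Arthur accepts on input `x` and witness `ψ`, after all `q` queries. -/
noncomputable def acceptProb (A : Arthur n m q) (x : Fin n → Bool)
    (ψ : EuclideanSpace ℂ (Fin m → Bool)) : ℝ :=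
  ∑ l ∈ A.accepting, ‖A.stateAfter x ψ q (Nat.lt_succ_self q) l‖ ^ 2

end Arthur

/-- `f : X → {0,1}`, with `X ⊆ {0,1}^n`, has a QMA query protocol with witness length `m` and query
cost `q`: on every input in `f⁻¹(1)` some `m`-qubit witness state makes Arthur accept with
probability at least `2/3`, and on every input in `f⁻¹(0)` every `m`-qubit witness state makes
Arthur accept with probability at most `1/3`. Nothing is required outside `X`. -/
def HasQMAProtocol {n : ℕ} {X : Set (Fin n → Bool)} (f : X → Bool) (m q : ℕ) : Prop :=
  ∃ A : Arthur n m q,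
    (∀ x : X, f x = true →
      ∃ ψ : EuclideanSpace ℂ (Fin m → Bool), ‖ψ‖ = 1 ∧ 2 / 3 ≤ A.acceptProb x.1 ψ) ∧
    (∀ x : X, f x = false →
      ∀ ψ : EuclideanSpace ℂ (Fin m → Bool), ‖ψ‖ = 1 → A.acceptProb x.1 ψ ≤ 1 / 3)

/-- The point of `{0,1}^n ⊆ ℝ^n` with the given bits. -/
def toReal {n : ℕ} (x : Fin n → Bool) : Fin n → ℝ :=
  fun i => if x i then 1 else 0

end QMAQuery

/-! For each input the acceptance probability is a quadratic form in the witness, given by a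
positive semidefinite matrix `acceptanceMatrix` of size `2 ^ m`. Its eigenvalues are acceptance
probabilities of eigenvector witnesses: all are at most 1/3 on 0-inputs, and one is at least 2/3 on
1-inputs. Amplitudes gain one degree per query (`hasDegreeLE_stateAfter`), so the entries have
degree at most `2 * q`, and the trace of the `2 * m`-th power has degree at most `4 * m * q`. This
trace is the power sum of the eigenvalues: the power widens the gap between 1/3 and 2/3 enough to
absorb the `2 ^ m` terms, and rescaling gives the bounds. -/

open Matrix

/-! ### Spectral facts on Hermitian matrices -/

namespace Matrix.IsHermitian

variable {ι : Type*} [Fintype ι] [DecidableEq ι] {M : Matrix ι ι ℂ}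

/-- The trace of a power of a Hermitian matrix is the power sum of its eigenvalues. -/
theorem trace_pow_eq_sum_eigenvalues_pow (hM : M.IsHermitian) (k : ℕ) :
    (M ^ k).trace = ∑ i, (hM.eigenvalues i : ℂ) ^ k := by
  conv_lhs => rw [hM.spectral_theorem, ← map_pow, Unitary.conjStarAlgAut_apply, trace_mul_cycle]
  simp [diagonal_pow, trace_diagonal]

/-- The quadratic form of a Hermitian matrix, expanded in an eigenbasis. -/
theorem re_star_dotProduct_mulVec_eq_sum (hM : M.IsHermitian) (v : EuclideanSpace ℂ ι) :
    (star ⇑v ⬝ᵥ M *ᵥ ⇑v).re =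
      ∑ i, hM.eigenvalues i * ‖inner ℂ (hM.eigenvectorBasis i) v‖ ^ 2 := by
  have key (i : ι) : inner ℂ (hM.eigenvectorBasis i) (WithLp.toLp 2 (M *ᵥ ⇑v)) =
      hM.eigenvalues i * inner ℂ (hM.eigenvectorBasis i) v := by
    have h := hM.mulVec_eigenvectorBasis i
    have hstar (u : ι → ℂ) : star u ᵥ* M = star (M *ᵥ u) := by rw [star_mulVec, hM.eq]
    rw [EuclideanSpace.inner_eq_star_dotProduct, EuclideanSpace.inner_eq_star_dotProduct,
      dotProduct_comm, dotProduct_mulVec, hstar, h, star_smul, smul_dotProduct, dotProduct_comm]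
    simp
  have h : star ⇑v ⬝ᵥ M *ᵥ ⇑v = inner ℂ v (WithLp.toLp 2 (M *ᵥ ⇑v)) := by
    rw [EuclideanSpace.inner_eq_star_dotProduct, dotProduct_comm]
  rw [h, ← hM.eigenvectorBasis.sum_inner_mul_inner, Complex.re_sum]
  refine Finset.sum_congr rfl fun i _ => ?_
  rw [key, mul_left_comm, ← inner_conj_symm v, ← Complex.normSq_eq_conj_mul_self,
    Complex.normSq_eq_norm_sq, ← Complex.ofReal_mul, Complex.ofReal_re]

/-- Some eigenvalue is at least the value of the quadratic form at a unit vector. -/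
theorem exists_le_eigenvalues (hM : M.IsHermitian) {v : EuclideanSpace ℂ ι} (hv : ‖v‖ = 1)
    {c : ℝ} (hc : c ≤ (star ⇑v ⬝ᵥ M *ᵥ ⇑v).re) : ∃ i, c ≤ hM.eigenvalues i := by
  by_contra! h
  have hsum := hM.eigenvectorBasis.sum_sq_norm_inner_right v
  rw [hv, one_pow] at hsum
  -- A nonzero weight is needed to make the comparison of weighted averages strict.
  obtain ⟨i, -, hi⟩ : ∃ i ∈ Finset.univ, ‖inner ℂ (hM.eigenvectorBasis i) v‖ ^ 2 ≠ 0 :=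
    Finset.exists_ne_zero_of_sum_ne_zero (by rw [hsum]; exact one_ne_zero)
  have hlt : ∑ i, hM.eigenvalues i * ‖inner ℂ (hM.eigenvectorBasis i) v‖ ^ 2 <
      ∑ i, c * ‖inner ℂ (hM.eigenvectorBasis i) v‖ ^ 2 :=
    Finset.sum_lt_sum (fun j _ => mul_le_mul_of_nonneg_right (h j).le (sq_nonneg _))
      ⟨i, Finset.mem_univ i, mul_lt_mul_of_pos_right (h i) (lt_of_le_of_ne (sq_nonneg _) hi.symm)⟩
  rw [← Finset.mul_sum, hsum, mul_one, ← hM.re_star_dotProduct_mulVec_eq_sum] at hlt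
  exact hlt.not_ge hc

end Matrix.IsHermitian

theorem Matrix.star_dotProduct_conjTranspose_mul_self_mulVec {κ ι : Type*} [Fintype κ] [Fintype ι]
    (G : Matrix κ ι ℂ) (v : ι → ℂ) :
    (star v ⬝ᵥ (Gᴴ * G) *ᵥ v).re = ∑ l, ‖(G *ᵥ v) l‖ ^ 2 := by
  rw [← mulVec_mulVec, dotProduct_mulVec, ← star_mulVec, dotProduct, Complex.re_sum]
  refine Finset.sum_congr rfl fun l _ => ?_
  rw [Pi.star_apply, Complex.star_def, ← Complex.normSq_eq_conj_mul_self, Complex.ofReal_re,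
    Complex.normSq_eq_norm_sq]

/-! ### Degree calculus on the Boolean cube -/

namespace QMAQuery

/-- `g` agrees on the Boolean cube with a complex polynomial of total degree at most `d`, given by
its real and imaginary parts. -/
def HasDegreeLE {n : ℕ} (d : ℕ) (g : (Fin n → Bool) → ℂ) : Prop :=
  ∃ p r : MvPolynomial (Fin n) ℝ, p.totalDegree ≤ d ∧ r.totalDegree ≤ d ∧
    ∀ x, g x = ⟨MvPolynomial.eval (toReal x) p, MvPolynomial.eval (toReal x) r⟩

namespace HasDegreeLE

variable {n d e : ℕ} {g h : (Fin n → Bool) → ℂ}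

theorem const (c : ℂ) : HasDegreeLE (n := n) d fun _ => c :=
  ⟨MvPolynomial.C c.re, MvPolynomial.C c.im, by simp, by simp, fun _ => by simp⟩

theorem add (hg : HasDegreeLE d g) (hh : HasDegreeLE d h) :
    HasDegreeLE d fun x => g x + h x := by
  obtain ⟨p, r, hp, hr, hg⟩ := hg
  obtain ⟨p', r', hp', hr', hh⟩ := hh
  refine ⟨p + p', r + r', (MvPolynomial.totalDegree_add _ _).trans (max_le hp hp'),
    (MvPolynomial.totalDegree_add _ _).trans (max_le hr hr'), fun x => ?_⟩
  simp only [hg, hh]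
  apply Complex.ext <;> simp

theorem mul (hg : HasDegreeLE d g) (hh : HasDegreeLE e h) :
    HasDegreeLE (d + e) fun x => g x * h x := by
  obtain ⟨p, r, hp, hr, hg⟩ := hg
  obtain ⟨p', r', hp', hr', hh⟩ := hh
  have hmul {a b : MvPolynomial (Fin n) ℝ} (ha : a.totalDegree ≤ d) (hb : b.totalDegree ≤ e) :
      (a * b).totalDegree ≤ d + e :=
    (MvPolynomial.totalDegree_mul a b).trans (add_le_add ha hb)
  refine ⟨p * p' - r * r', p * r' + r * p',
    (MvPolynomial.totalDegree_sub _ _).trans (max_le (hmul hp hp') (hmul hr hr')),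
    (MvPolynomial.totalDegree_add _ _).trans (max_le (hmul hp hr') (hmul hr hp')), fun x => ?_⟩
  simp only [hg, hh]
  apply Complex.ext <;> simp

/-- Evaluation points are real, so conjugation only negates the imaginary part. -/
theorem conj (hg : HasDegreeLE d g) : HasDegreeLE d fun x => star (g x) := by
  obtain ⟨p, r, hp, hr, hg⟩ := hg
  refine ⟨p, -r, hp, by rwa [MvPolynomial.totalDegree_neg], fun x => ?_⟩
  simp only [hg]
  apply Complex.ext <;> simp

theorem sum {ι : Type*} (s : Finset ι) {g : ι → (Fin n → Bool) → ℂ}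
    (hg : ∀ i, HasDegreeLE d (g i)) : HasDegreeLE d fun x => ∑ i ∈ s, g i x := by
  classical
  induction s using Finset.induction_on with
  | empty => simpa using const 0
  | insert i s hi ih => simpa [Finset.sum_insert hi] using (hg i).add ih

theorem const_mul (c : ℂ) (hg : HasDegreeLE d g) : HasDegreeLE d fun x => c * g x := by
  simpa using (const (d := 0) c).mul hg

theorem mono (hg : HasDegreeLE d g) (hde : d ≤ e) : HasDegreeLE e g := by
  obtain ⟨p, r, hp, hr, hg⟩ := hg
  exact ⟨p, r, hp.trans hde, hr.trans hde, hg⟩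

theorem bit (i : Fin n) (a b : ℂ) : HasDegreeLE 1 fun x => if x i then a else b := by
  have hX : HasDegreeLE 1 fun x : Fin n → Bool => if x i then (1 : ℂ) else 0 := by
    refine ⟨MvPolynomial.X i, 0, by simp, by simp, fun x => ?_⟩
    cases hx : x i <;> apply Complex.ext <;> simp [toReal, hx]
  convert (const b).add (hX.const_mul (a - b)) using 2 with x
  cases x i <;> simp

theorem ite (i : Fin n) (hg : HasDegreeLE d g) (hh : HasDegreeLE d h) :
    HasDegreeLE (d + 1) fun x => if x i then g x else h x := by
  convert (hg.mul (bit i 1 0)).add (hh.mul (bit i 0 1)) using 2 with x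
  cases x i <;> simp

theorem matrix_pow {ι : Type*} [Fintype ι] [DecidableEq ι]
    {M : (Fin n → Bool) → Matrix ι ι ℂ} (hM : ∀ i j, HasDegreeLE d fun x => M x i j) (k : ℕ) :
    ∀ i j, HasDegreeLE (k * d) fun x => (M x ^ k) i j := by
  induction k with
  | zero => intro i j; simpa using const _
  | succ k ih =>
    intro i j
    simp only [pow_succ, Matrix.mul_apply, Nat.succ_mul]
    exact sum _ fun l => (ih i l).mul (hM l j)

end HasDegreeLE

/-! ### The acceptance operator and its power sums -/

namespace Arthur

variable {n m q : ℕ}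

/-- After `k` queries, every amplitude is a polynomial of degree at most `k` in the input. -/
theorem hasDegreeLE_stateAfter (A : Arthur n m q) (ψ : EuclideanSpace ℂ (Fin m → Bool)) (k : ℕ)
    (hk : k < q + 1) (l : Label n m A.work) :
    HasDegreeLE k fun x => A.stateAfter x ψ k hk l := by
  induction k generalizing l with
  | zero => exact HasDegreeLE.const _
  | succ k ih =>
    refine HasDegreeLE.sum _ fun l' => HasDegreeLE.const_mul _ ?_
    obtain ⟨i, b, w, z⟩ := l'
    cases i with
    | none =>
      convert (ih (Nat.lt_of_succ_lt hk) (none, b, w, z)).mono k.le_succ using 2 with x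
      simp [oracle, answer]
    | some i =>
      -- The bit `x i` selects one of two old amplitudes; this selection costs one degree.
      convert (ih (Nat.lt_of_succ_lt hk) (some i, !b, w, z)).ite i
        (ih (Nat.lt_of_succ_lt hk) (some i, b, w, z)) using 2 with x
      cases hx : x i <;> simp [oracle, answer, hx]

/-- The amplitudes depend linearly on the witness. -/
theorem stateAfter_eq_sum (A : Arthur n m q) (x : Fin n → Bool)
    (ψ : EuclideanSpace ℂ (Fin m → Bool)) (k : ℕ) (hk : k < q + 1) (l : Label n m A.work) :
    A.stateAfter x ψ k hk l =
      ∑ w, A.stateAfter x (EuclideanSpace.single w 1) k hk l * ψ w := by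
  induction k generalizing l with
  | zero =>
    have h (l' : Label n m A.work) : initial ψ l' =
        ∑ w, initial (EuclideanSpace.single w 1) l' * ψ w := by
      obtain ⟨i, b, w, z⟩ := l'
      simp only [initial]
      split_ifs <;> simp
    simp only [stateAfter, mulVec, dotProduct, Finset.sum_mul]
    rw [Finset.sum_comm]
    refine Finset.sum_congr rfl fun l' _ => ?_
    rw [h, Finset.mul_sum]
    simp only [mul_assoc]
  | succ k ih =>
    simp only [stateAfter, mulVec, dotProduct, Finset.sum_mul]
    rw [Finset.sum_comm]
    refine Finset.sum_congr rfl fun ⟨i, b, w, z⟩ _ => ?_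
    simp only [oracle, mul_assoc]
    rw [ih, Finset.mul_sum]

/-- The accepting amplitudes, as a linear map of the witness. -/
noncomputable def acceptingAmplitudes (A : Arthur n m q) (x : Fin n → Bool) :
    Matrix A.accepting (Fin m → Bool) ℂ :=
  Matrix.of fun l w => A.stateAfter x (EuclideanSpace.single w 1) q (Nat.lt_succ_self q) l

/-- The acceptance operator on the witness space. -/
noncomputable def acceptanceMatrix (A : Arthur n m q) (x : Fin n → Bool) :
    Matrix (Fin m → Bool) (Fin m → Bool) ℂ :=
  (A.acceptingAmplitudes x)ᴴ * A.acceptingAmplitudes x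

theorem isHermitian_acceptanceMatrix (A : Arthur n m q) (x : Fin n → Bool) :
    (A.acceptanceMatrix x).IsHermitian :=
  isHermitian_conjTranspose_mul_self _

theorem acceptProb_eq (A : Arthur n m q) (x : Fin n → Bool)
    (ψ : EuclideanSpace ℂ (Fin m → Bool)) :
    A.acceptProb x ψ = (star ⇑ψ ⬝ᵥ A.acceptanceMatrix x *ᵥ ⇑ψ).re := by
  rw [acceptanceMatrix, star_dotProduct_conjTranspose_mul_self_mulVec, acceptProb,
    ← Finset.sum_coe_sort]
  refine Finset.sum_congr rfl fun l _ => ?_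
  rw [stateAfter_eq_sum]
  rfl

theorem hasDegreeLE_acceptanceMatrix (A : Arthur n m q) (w w' : Fin m → Bool) :
    HasDegreeLE (q + q) fun x => A.acceptanceMatrix x w w' := by
  simp only [acceptanceMatrix, Matrix.mul_apply, conjTranspose_apply]
  exact HasDegreeLE.sum _ fun l =>
    (A.hasDegreeLE_stateAfter _ _ _ _).conj.mul (A.hasDegreeLE_stateAfter _ _ _ _)

/-- An eigenvalue is the quadratic form at its unit eigenvector. This transfers nonnegativity and
soundness to the spectrum. -/
theorem eigenvalues_eq_acceptProb (A : Arthur n m q) (x : Fin n → Bool) (i : Fin m → Bool) :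
    (A.isHermitian_acceptanceMatrix x).eigenvalues i =
      A.acceptProb x ((A.isHermitian_acceptanceMatrix x).eigenvectorBasis i) := by
  rw [acceptProb_eq, Matrix.IsHermitian.eigenvalues_eq]
  rfl

/-- The power sums of the eigenvalues of the acceptance operator are polynomials in the input. -/
theorem exists_polynomial_sum_eigenvalues_pow (A : Arthur n m q) (k : ℕ) :
    ∃ p : MvPolynomial (Fin n) ℝ, p.totalDegree ≤ k * (q + q) ∧
      ∀ x, MvPolynomial.eval (toReal x) p =
        ∑ i, (A.isHermitian_acceptanceMatrix x).eigenvalues i ^ k := by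
  have h : HasDegreeLE (k * (q + q)) fun x => (A.acceptanceMatrix x ^ k).trace :=
    HasDegreeLE.sum _ fun i => HasDegreeLE.matrix_pow A.hasDegreeLE_acceptanceMatrix k i i
  obtain ⟨p, r, hp, -, h⟩ := h
  refine ⟨p, hp, fun x => ?_⟩
  have hx := congrArg Complex.re (h x)
  simp only [(A.isHermitian_acceptanceMatrix x).trace_pow_eq_sum_eigenvalues_pow] at hx
  rw [← hx]
  norm_cast

end Arthur

end QMAQuery

theorem mainTheorem9 :
    ∃ C : ℕ, ∀ (n m q : ℕ) (X : Set (Fin n → Bool)) (f : X → Bool),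
      QMAQuery.HasQMAProtocol f m q →
      ∃ p : MvPolynomial (Fin n) ℝ,
        p.totalDegree ≤ C * (m * q) ∧
        (∀ x : X, f x = false →
          |MvPolynomial.eval (QMAQuery.toReal x.1) p| ≤ (2 : ℝ) ^ (-(2 * (m : ℤ)))) ∧
        (∀ x : X, f x = true →
          (2 : ℝ) ^ (-(m : ℤ) - 1) ≤ MvPolynomial.eval (QMAQuery.toReal x.1) p) := by
  refine ⟨4, fun n m q X f ⟨A, hone, hzero⟩ => ?_⟩
  obtain ⟨p, hp, hpe⟩ := A.exists_polynomial_sum_eigenvalues_pow (2 * m)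
  -- The first factor cancels the number of eigenvalues on 0-inputs; the second turns 1/3 into 1/2
  -- and 2/3 into 1.
  set c : ℝ := ((2 : ℝ) ^ m)⁻¹ * (3 / 2) ^ (2 * m) with hc
  have hc0 : 0 ≤ c := by positivity
  have hnonneg (x : Fin n → Bool) (i : Fin m → Bool) :
      0 ≤ (A.isHermitian_acceptanceMatrix x).eigenvalues i := by
    rw [A.eigenvalues_eq_acceptProb]
    exact Finset.sum_nonneg fun _ _ => sq_nonneg _
  refine ⟨MvPolynomial.C c * p, ?_, fun x hx => ?_, fun x hx => ?_⟩
  · refine (MvPolynomial.totalDegree_mul _ _).trans ?_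
    rw [MvPolynomial.totalDegree_C, zero_add]
    exact hp.trans (by ring_nf; rfl)
  · rw [map_mul, MvPolynomial.eval_C, hpe, abs_of_nonneg
      (mul_nonneg hc0 (Finset.sum_nonneg fun i _ => pow_nonneg (hnonneg x i) _))]
    have hle : ∑ i, (A.isHermitian_acceptanceMatrix x).eigenvalues i ^ (2 * m) ≤
        ∑ _i : Fin m → Bool, (1 / 3 : ℝ) ^ (2 * m) := by
      refine Finset.sum_le_sum fun i _ => pow_le_pow_left₀ (hnonneg x i) ?_ _
      rw [A.eigenvalues_eq_acceptProb]
      exact hzero x hx _ (OrthonormalBasis.norm_eq_one _ i)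
    refine (mul_le_mul_of_nonneg_left hle hc0).trans_eq ?_
    rw [_root_.zpow_neg, ← _root_.inv_zpow, show (2 * (m : ℤ)) = ((2 * m : ℕ) : ℤ) by push_cast; rfl,
      _root_.zpow_natCast, show (2⁻¹ : ℝ) = 3 / 2 * (1 / 3) by norm_num, mul_pow, hc]
    simp only [Finset.sum_const, Finset.card_univ, Fintype.card_pi, Fintype.card_bool,
      Finset.prod_const, Fintype.card_fin, nsmul_eq_mul]
    push_cast
    field_simp
  · rw [map_mul, MvPolynomial.eval_C, hpe]
    obtain ⟨ψ, hψ, hacc⟩ := hone x hx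
    rw [A.acceptProb_eq] at hacc
    obtain ⟨i, hi⟩ := (A.isHermitian_acceptanceMatrix x).exists_le_eigenvalues hψ hacc
    -- The largest eigenvalue alone already gives `2 ^ (-m)`, twice what is required.
    calc (2 : ℝ) ^ (-(m : ℤ) - 1) ≤ 2 ^ (-(m : ℤ)) :=
          _root_.zpow_le_zpow_right₀ (by norm_num) (by omega)
      _ = c * (2 / 3) ^ (2 * m) := by
          rw [hc, mul_assoc, ← mul_pow]
          norm_num
      _ ≤ c * (A.isHermitian_acceptanceMatrix x).eigenvalues i ^ (2 * m) :=
          mul_le_mul_of_nonneg_left (pow_le_pow_left₀ (by norm_num) hi _) hc0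
      _ ≤ _ := mul_le_mul_of_nonneg_left
          (Finset.single_le_sum (fun j _ => pow_nonneg (hnonneg x j) _) (Finset.mem_univ i)) hc0
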